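/- **Soundness.** Fix sets of participants, of labels and of types $U$ of exchanged messages. *Global types* are given by $$G ::= g;G \mid p\to q:\{l_i:G_i\}_{i\in I} \mid \mathbf t \mid \mu\mathbf t.G \mid \mathsf{end},\qquad g ::= p\to q:\langle U\rangle ,$$ with $I$ finite and nonempty and the labels $l_i$ pairwise distinct; types are taken up to renaming of bound recursion variables. Let $\mathsf{pid}(g)=\{p,q\}$, and similarly $\{p,q\}$ for a branching $p\to q:\{\dots\}$. *Isomorphism* $G_1\cong G_2$ is the smallest congruence (equivalence relation closed under all the constructors above) that contains * prefix swap: $g;g';G\cong g';g;G$, * branching contraction/expansion: $p\to q:\{l_i: g;G_i\}_{i\in I}\cong g;\,p\to q:\{l_i:G_i\}_{i\in I}$, * branching distributivity: $p\to q:\{l_i:\ p'\to q':\{l'_k:G_k\}_{k\in K}\}_{i\in I}\cong p'\to q':\{l'_k:\ p\to q:\{l_i:G_k\}_{i\in I}\}_{k\in K}$, in each case provided that the participants of the two exchanged communications are disjoint. *Local types* are given by $$T::= q!\langle U\rangle;T\mid p?\langle U\rangle;T\mid q\oplus\{l_i:T_i\}\mid p\,\&\,\{l_i:T_i\}\mid\mathbf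 t\mid\mu\mathbf t.T\mid\mathsf{end}.$$ Their transitions are $q!\langle U\rangle;T\xrightarrow{q!\langle U\rangle}T$, $p?\langle U\rangle;T\xrightarrow{p?\langle U\rangle}T$, $q\oplus\{l_i:T_i\}\xrightarrow{q!l_j}T_j$, $p\,\&\,\{l_i:T_i\}\xrightarrow{p?l_j}T_j$, and $\mu\mathbf t.T\xrightarrow{\ell}T'$ whenever $T[\mu\mathbf t.T/\mathbf t]\xrightarrow{\ell}T'$. The *merge* $\sqcup$ is a partial operation on nonempty finite families of local types: receiving branchings $p\,\&\,\{\dots\}$ from the same participant $p$ are merged by taking the union of their label sets and merging the continuations of each label over the members that have it; otherwise all members must have the same outermost constructor with the same data, and their continuations are merged. The *projection* $G{\upharpoonright} r$ is the partial operation with $\mathsf{end}{\upharpoonright} r=\mathsf{end}$, $\mathbf t{\upharpoonright} r=\mathbf t$; $(\mu\mathbf t.G){\upharpoonright} r=\mu\mathbf t.(G{\upharpoonright} r)$ if $G{\upharpoonright} r\ne\mathbf t$, and $\mathsf{end}$ otherwise; $(p\to q:\langle U\rangle;G){\upharpoonright} r$ is $q!\langle U\rangle;(G{\upharpoonright} r)$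 if $r=p$, $p?\langle U\rangle;(G{\upharpoonright} r)$ if $r=q$, and $G{\upharpoonright} r$ otherwise; $(p\to q:\{l_i:G_i\}){\upharpoonright} r$ is $q\oplus\{l_i:G_i{\upharpoonright} r\}$ if $r=p$, $p\,\&\,\{l_i:G_i{\upharpoonright} r\}$ if $r=q$, and $\bigsqcup_i G_i{\upharpoonright} r$ otherwise. A *configuration* over a set $\mathcal P$ of participants is a family $\Delta=(T_p)_{p\in\mathcal P}$ of local types. It has a synchronous transition $(T_r)_r\to(T'_r)_r$ with label $q!m\cdot p?m$, where $p\ne q$ and $m$ is a message type $\langle U\rangle$ or a label, if $T_p\xrightarrow{q!m}T'_p$, $T_q\xrightarrow{p?m}T'_q$ and $T'_r=T_r$ for all other $r$. A *configuration trace* $\sigma$ maps participants to finite sequences of local actions. $\Delta$ *executes* $\sigma$ to $\Delta'$ if there is a finite sequence of synchronous transitions from $\Delta$ to $\Delta'$ such that $\sigma(r)$ is the sequence of the actions performed by $r$, for every $r$. Let $\mathcal T_S(\Delta)$ be the set of configuration traces that $\Delta$ executes, and let $\mathbf D(G)$ be the set of configuration traces that $(G{\upharpoonright} p)_{p\in\mathcal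 P}$, with $\mathcal P$ the set of participants of $G$, executes to a configuration without synchronous transitions ($\mathbf D(G)=\emptyset$ if one of these projections is undefined). **Theorem.** Let $G_1\cong G_2$. If $\Delta_i=(G_i{\upharpoonright} p)_{p\in\mathcal P}$, $i\in\{1,2\}$, are the projected configurations over any set $\mathcal P$ of participants (in particular, over the participants of $G_1$), then $\Delta_1$ and $\Delta_2$ can perform the same finite sequences of synchronous transition labels, and $\mathcal T_S(\Delta_1)=\mathcal T_S(\Delta_2)$. Moreover $\mathbf D(G_1)=\mathbf D(G_2)$. -/

import Mathlib

/-! Multiparty session types over a set `P` of participants, a set `L` of labels and a set `V` of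
types of exchanged messages.  Recursion variables are de Bruijn indices (types are taken up to
renaming of bound variables). A family of labelled branches `{lᵢ : Xᵢ}` is a function on a
nonempty finite set of labels, so its labels are pairwise distinct and its order is immaterial. -/

/-- Global types: `comm p q U G` is `p → q : ⟨U⟩; G`, and `branch p q S _ G` is
`p → q : {l : G l}` with `l` ranging over `S`. -/
inductive GType (P L V : Type*) where
  | comm (p q : P) (U : V) (G : GType P L V) : GType P L V
  | branch (p q : P) (S : Finset L) (hS : S.Nonempty) (G : S → GType P L V) : GType P L V
  | var (n : ℕ) : GType P L V
  | mu (G : GType P L V) : GType P L V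
  | ended : GType P L V

/-- Local types: `send q U T` is `q!⟨U⟩; T`, `recv p U T` is `p?⟨U⟩; T`,
`select q S _ T` is `q ⊕ {l : T l}`, and `branch p S _ T` is `p & {l : T l}`. -/
inductive LType (P L V : Type*) where
  | send (q : P) (U : V) (T : LType P L V) : LType P L V
  | recv (p : P) (U : V) (T : LType P L V) : LType P L V
  | select (q : P) (S : Finset L) (hS : S.Nonempty) (T : S → LType P L V) : LType P L V
  | branch (p : P) (S : Finset L) (hS : S.Nonempty) (T : S → LType P L V) : LType P L V
  | var (n : ℕ) : LType P L V
  | mu (T : LType P L V) : LType P L V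
  | ended : LType P L V

/-- Messages: a value type `⟨U⟩` or a label `l`. -/
inductive Msg (L V : Type*) where
  | val (U : V) : Msg L V
  | lab (l : L) : Msg L V

/-- Labels of local types: `snd q m` is `q!m`, and `rcv p m` is `p?m`. -/
inductive Act (P L V : Type*) where
  | snd (q : P) (m : Msg L V) : Act P L V
  | rcv (p : P) (m : Msg L V) : Act P L V

section

variable {P L V : Type*}

namespace GType

/-- The participants occurring in a global type. -/
def participants : GType P L V → Set P
  | comm p q _ G => {p, q} ∪ G.participants
  | branch p q _ _ G => {p, q} ∪ ⋃ l, (G l).participants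
  | var _ => ∅
  | mu G => G.participants
  | ended => ∅

/-- Isomorphism of global types: the smallest congruence containing the three pairs of mutually
inverse combinators (swapping of two communications, contraction and expansion of a branching,
distributivity of branching), each for disjoint sets of participants. -/
inductive Iso : GType P L V → GType P L V → Prop
  | swap (p q : P) (U : V) (p' q' : P) (U' : V) (G : GType P L V)
      (h : Disjoint ({p, q} : Set P) {p', q'}) :
      Iso (comm p q U (comm p' q' U' G)) (comm p' q' U' (comm p q U G))
  | contr (p q : P) (S : Finset L) (hS : S.Nonempty) (p' q' : P) (U : V) (G : S → GType P L V)
      (h : Disjoint ({p, q} : Set P) {p', q'}) :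
      Iso (branch p q S hS (fun l => comm p' q' U (G l))) (comm p' q' U (branch p q S hS G))
  | distrib (p q : P) (S : Finset L) (hS : S.Nonempty) (p' q' : P) (S' : Finset L)
      (hS' : S'.Nonempty) (G : S' → GType P L V) (h : Disjoint ({p, q} : Set P) {p', q'}) :
      Iso (branch p q S hS (fun _ => branch p' q' S' hS' (fun k => G k)))
        (branch p' q' S' hS' (fun k => branch p q S hS (fun _ => G k)))
  | refl (G : GType P L V) : Iso G G
  | symm {G G' : GType P L V} : Iso G G' → Iso G' G
  | trans {G G' G'' : GType P L V} : Iso G G' → Iso G' G'' → Iso G G''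
  | comm_congr (p q : P) (U : V) {G G' : GType P L V} :
      Iso G G' → Iso (comm p q U G) (comm p q U G')
  | branch_congr (p q : P) (S : Finset L) (hS : S.Nonempty) {G G' : S → GType P L V} :
      (∀ l, Iso (G l) (G' l)) → Iso (branch p q S hS G) (branch p q S hS G')
  | mu_congr {G G' : GType P L V} : Iso G G' → Iso (mu G) (mu G')

end GType

namespace LType

/-- Renaming of free recursion variables. -/
def rename : (ℕ → ℕ) → LType P L V → LType P L V
  | f, send q U T => send q U (T.rename f)
  | f, recv p U T => recv p U (T.rename f)
  | f, select q S hS T => select q S hS (fun l => (T l).rename f)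
  | f, branch p S hS T => branch p S hS (fun l => (T l).rename f)
  | f, var n => var (f n)
  | f, mu T => mu (T.rename (fun n => Nat.casesOn n 0 (fun k => f k + 1)))
  | _, ended => ended

/-- Simultaneous capture-avoiding substitution for the free recursion variables. -/
def subst : (ℕ → LType P L V) → LType P L V → LType P L V
  | s, send q U T => send q U (T.subst s)
  | s, recv p U T => recv p U (T.subst s)
  | s, select q S hS T => select q S hS (fun l => (T l).subst s)
  | s, branch p S hS T => branch p S hS (fun l => (T l).subst s)
  | s, var n => s n
  | s, mu T => mu (T.subst (fun n => Nat.casesOn n (var 0) (fun k => (s k).rename Nat.succ)))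
  | _, ended => ended

/-- `T[μt.T/t]`, where `t` is the variable with index `0` in `T`. -/
def unfold (T : LType P L V) : LType P L V :=
  T.subst (fun n => Nat.casesOn n (mu T) var)

/-- The operational semantics of local types. -/
inductive Step : LType P L V → Act P L V → LType P L V → Prop
  | lin (p : P) (U : V) (T : LType P L V) : Step (recv p U T) (Act.rcv p (Msg.val U)) T
  | lout (q : P) (U : V) (T : LType P L V) : Step (send q U T) (Act.snd q (Msg.val U)) T
  | lbra (p : P) (S : Finset L) (hS : S.Nonempty) (T : S → LType P L V) (l : S) :
      Step (branch p S hS T) (Act.rcv p (Msg.lab (l : L))) (T l)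
  | lsel (q : P) (S : Finset L) (hS : S.Nonempty) (T : S → LType P L V) (l : S) :
      Step (select q S hS T) (Act.snd q (Msg.lab (l : L))) (T l)
  | lrec (T : LType P L V) (a : Act P L V) (T' : LType P L V) :
      Step T.unfold a T' → Step (mu T) a T'

/-- `IsMerge U A`: the types in `A` are mergeable and `U` is their merge `⊔ A`.  Receiving
branchings from the same participant are merged by taking the union of their label sets and by
merging the continuations that share a label; every other type constructor has to agree in all
members of `A`, and merging goes under it. -/
def IsMerge : LType P L V → Set (LType P L V) → Prop
  | send q U T, A => ∃ B, A = send q U '' B ∧ IsMerge T B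
  | recv p U T, A => ∃ B, A = recv p U '' B ∧ IsMerge T B
  | select q S hS T, A =>
      ∃ B : Set (S → LType P L V), A = select q S hS '' B ∧
        ∀ l, IsMerge (T l) ((fun K => K l) '' B)
  | branch p S _ T, A =>
      (∀ X ∈ A, ∃ S' hS' K, X = branch p S' hS' K ∧ S' ⊆ S) ∧
        ∀ l : S, IsMerge (T l) {Y | ∃ S' hS' K, ∃ h : (l : L) ∈ S',
          branch p S' hS' K ∈ A ∧ Y = K ⟨l, h⟩}
  | var n, A => A = {var n}
  | mu T, A => ∃ B, A = mu '' B ∧ IsMerge T B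
  | ended, A => A = {ended}

end LType

open Classical in
/-- `IsProj r G T`: the projection of `G` onto the participant `r` is defined and equal to `T`. -/
def IsProj (r : P) : GType P L V → LType P L V → Prop
  | .comm p q U G, T =>
      if r = p then ∃ T', IsProj r G T' ∧ T = .send q U T'
      else if r = q then ∃ T', IsProj r G T' ∧ T = .recv p U T'
      else IsProj r G T
  | .branch p q S hS G, T =>
      ∃ T' : S → LType P L V, (∀ l, IsProj r (G l) (T' l)) ∧
        if r = p then T = .select q S hS T'
        else if r = q then T = .branch p S hS T'
        else T.IsMerge (Set.range T')
  | .var n, T => T = .var n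
  | .mu G, T => ∃ T', IsProj r G T' ∧ if T' = .var 0 then T = .ended else T = .mu T'
  | .ended, T => T = .ended

/-- Configurations `(T_p)` with `p` ranging over a set `R` of participants. -/
abbrev Config (P L V : Type*) (R : Set P) := R → LType P L V

/-- `Δ` is the configuration over `R` of the projections of `G`. -/
def IsProjConfig {R : Set P} (G : GType P L V) (Δ : Config P L V R) : Prop :=
  ∀ p : R, IsProj (p : P) G (Δ p)

/-- The synchronous transition with label `q!m · p?m`: `p` sends `m` to `q`. -/
def SyncStep {R : Set P} (Δ : Config P L V R) (p q : R) (m : Msg L V)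
    (Δ' : Config P L V R) : Prop :=
  p ≠ q ∧ (Δ p).Step (Act.snd (q : P) m) (Δ' p) ∧ (Δ q).Step (Act.rcv (p : P) m) (Δ' q) ∧
    ∀ r, r ≠ p → r ≠ q → Δ' r = Δ r

/-- Configuration traces. -/
abbrev ConfTrace (P L V : Type*) := P → List (Act P L V)

/-- Synchronous execution of a configuration trace. -/
inductive Exec {R : Set P} : Config P L V R → ConfTrace P L V → Config P L V R → Prop
  | nil (Δ : Config P L V R) : Exec Δ (fun _ => []) Δ
  | step {Δ Δ₁ Δ₂ : Config P L V R} {σ σ' : ConfTrace P L V} {p q : R} {m : Msg L V} :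
      Exec Δ σ Δ₁ → SyncStep Δ₁ p q m Δ₂ →
      σ' p = σ p ++ [Act.snd (q : P) m] → σ' q = σ q ++ [Act.rcv (p : P) m] →
      (∀ r : P, r ≠ p → r ≠ q → σ' r = σ r) → Exec Δ σ' Δ₂

/-- The set `𝒯_S(Δ)` of configuration traces that `Δ` executes. -/
def traceSet {R : Set P} (Δ : Config P L V R) : Set (ConfTrace P L V) :=
  {σ | ∃ Δ', Exec Δ σ Δ'}

/-- Synchronous runs, recorded as the sequence of transition labels `q!m · p?m`, each written as
the triple `(p, q, m)`. -/
inductive Run {R : Set P} :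
    Config P L V R → List (P × P × Msg L V) → Config P L V R → Prop
  | nil (Δ : Config P L V R) : Run Δ [] Δ
  | step {Δ Δ₁ Δ₂ : Config P L V R} {w : List (P × P × Msg L V)} {p q : R} {m : Msg L V} :
      Run Δ w Δ₁ → SyncStep Δ₁ p q m Δ₂ → Run Δ (w ++ [((p : P), (q : P), m)]) Δ₂

/-- The set of sequences of synchronous transition labels that `Δ` can perform. -/
def runSet {R : Set P} (Δ : Config P L V R) : Set (List (P × P × Msg L V)) :=
  {w | ∃ Δ', Run Δ w Δ'}

/-- The denotation of `G`: the terminated configuration traces of the configuration of the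
projections of `G` onto its participants. -/
def denotation (G : GType P L V) : Set (ConfTrace P L V) :=
  {σ | ∃ Δ Δ' : Config P L V G.participants, IsProjConfig G Δ ∧ Exec Δ σ Δ' ∧
    ¬ ∃ p q m Δ'', SyncStep Δ' p q m Δ''}

end

/-! Isomorphic global types have literally the same projections: for every `r`, either both
projections are undefined or they are equal (`GType.Iso.isProj_iff`). The projected configurations
therefore coincide, and so does all their behaviour; the transition relation is never analysed.

Each combinator exchanges two communications with disjoint participants, so `r` takes no part in at
least one of them. To `r`, a foreign message is invisible and a foreign branching is the merge of
its branches. The combinators then reduce to two facts about the merge: it commutes with a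
constructor shared by all members (the `isMerge_..._image` lemmas), and it is idempotent
(`isMerge_singleton_iff`). Projection is compositional, so the equivalence passes through the
congruence rules. For denotations, isomorphic types also have the same participants. -/

section

variable {P L V : Type*}

/-! ### The merge as a partial operation -/

namespace LType

/-- The merge of the empty family is undefined. -/
theorem not_isMerge_empty (T : LType P L V) : ¬ T.IsMerge ∅ := by
  induction T with
  | send q U T ih =>
    rintro ⟨B, hB, h⟩
    rw [eq_comm, Set.image_eq_empty] at hB
    exact ih (hB ▸ h)
  | recv q U T ih =>
    rintro ⟨B, hB, h⟩
    rw [eq_comm, Set.image_eq_empty] at hB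
    exact ih (hB ▸ h)
  | select q S hS T ih =>
    rintro ⟨B, hB, h⟩
    rw [eq_comm, Set.image_eq_empty] at hB
    -- A selection has at least one label, and the continuations at that label would again be merged
    -- from the empty family.
    obtain ⟨l, hl⟩ := hS
    have := h ⟨l, hl⟩
    rw [hB, Set.image_empty] at this
    exact ih _ this
  | branch p S hS T ih =>
    rintro ⟨-, h⟩
    obtain ⟨l, hl⟩ := hS
    have := h ⟨l, hl⟩
    refine ih _ (Eq.mp (congrArg _ ?_) this)
    ext; simp
  | var n => exact fun h => Set.singleton_ne_empty _ (Eq.symm h)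
  | mu T ih =>
    rintro ⟨B, hB, h⟩
    rw [eq_comm, Set.image_eq_empty] at hB
    exact ih (hB ▸ h)
  | ended => exact fun h => Set.singleton_ne_empty _ (Eq.symm h)

theorem IsMerge.nonempty {T : LType P L V} {A : Set (LType P L V)} (h : T.IsMerge A) :
    A.Nonempty := by
  rw [Set.nonempty_iff_ne_empty]
  rintro rfl
  exact not_isMerge_empty T h

theorem send_injective (q : P) (U : V) : Function.Injective (send (L := L) q U) :=
  fun _ _ h => by injection h

theorem recv_injective (q : P) (U : V) : Function.Injective (recv (L := L) q U) :=
  fun _ _ h => by injection h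

theorem mu_injective : Function.Injective (mu : LType P L V → LType P L V) :=
  fun _ _ h => by injection h

theorem select_injective (q : P) (S : Finset L) (hS : S.Nonempty) :
    Function.Injective (select (V := V) q S hS) :=
  fun _ _ h => by injection h

/-- A merge has at least one member, which determines the head constructor of the result;
injectivity of that constructor then recovers the set of continuations. This and its analogues pull
a common constructor out of a merge. -/
theorem isMerge_send_image {T : LType P L V} {q : P} {U : V} {B : Set (LType P L V)} :
    T.IsMerge (send q U '' B) ↔ ∃ T', T'.IsMerge B ∧ T = send q U T' := by
  constructor
  · intro h
    obtain ⟨_, b, hb, rfl⟩ := h.nonempty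
    have hm : send q U b ∈ send q U '' B := ⟨b, hb, rfl⟩
    cases T with
    | send q' U' T' =>
      obtain ⟨C, hC, h'⟩ := h
      have hm' := hm
      rw [hC] at hm'
      obtain ⟨c, -, hc⟩ := hm'
      injection hc with h1 h2
      subst h1 h2
      exact ⟨T', (send_injective _ _).image_injective hC ▸ h', rfl⟩
    | branch p S hS K =>
      obtain ⟨S', _, K', h1, -⟩ := h.1 _ hm
      cases h1
    | recv => obtain ⟨C, hC, -⟩ := h; rw [hC] at hm; obtain ⟨_, -, hc⟩ := hm; cases hc
    | select => obtain ⟨C, hC, -⟩ := h; rw [hC] at hm; obtain ⟨_, -, hc⟩ := hm; cases hc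
    | mu => obtain ⟨C, hC, -⟩ := h; rw [hC] at hm; obtain ⟨_, -, hc⟩ := hm; cases hc
    | var => rw [show _ = _ from h] at hm; cases hm
    | ended => rw [show _ = _ from h] at hm; cases hm
  · rintro ⟨T', h, rfl⟩
    exact ⟨B, rfl, h⟩

theorem isMerge_recv_image {T : LType P L V} {q : P} {U : V} {B : Set (LType P L V)} :
    T.IsMerge (recv q U '' B) ↔ ∃ T', T'.IsMerge B ∧ T = recv q U T' := by
  constructor
  · intro h
    obtain ⟨_, b, hb, rfl⟩ := h.nonempty
    have hm : recv q U b ∈ recv q U '' B := ⟨b, hb, rfl⟩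
    cases T with
    | recv q' U' T' =>
      obtain ⟨C, hC, h'⟩ := h
      have hm' := hm
      rw [hC] at hm'
      obtain ⟨c, -, hc⟩ := hm'
      injection hc with h1 h2
      subst h1 h2
      exact ⟨T', (recv_injective _ _).image_injective hC ▸ h', rfl⟩
    | branch p S hS K =>
      obtain ⟨S', _, K', h1, -⟩ := h.1 _ hm
      cases h1
    | send => obtain ⟨C, hC, -⟩ := h; rw [hC] at hm; obtain ⟨_, -, hc⟩ := hm; cases hc
    | select => obtain ⟨C, hC, -⟩ := h; rw [hC] at hm; obtain ⟨_, -, hc⟩ := hm; cases hc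
    | mu => obtain ⟨C, hC, -⟩ := h; rw [hC] at hm; obtain ⟨_, -, hc⟩ := hm; cases hc
    | var => rw [show _ = _ from h] at hm; cases hm
    | ended => rw [show _ = _ from h] at hm; cases hm
  · rintro ⟨T', h, rfl⟩
    exact ⟨B, rfl, h⟩

theorem isMerge_select_image {T : LType P L V} {q : P} {S : Finset L} {hS : S.Nonempty}
    {B : Set (S → LType P L V)} :
    T.IsMerge (select q S hS '' B) ↔
      ∃ T' : S → LType P L V, (∀ l, (T' l).IsMerge ((fun K => K l) '' B)) ∧
        T = select q S hS T' := by
  constructor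
  · intro h
    obtain ⟨_, b, hb, rfl⟩ := h.nonempty
    have hm : select q S hS b ∈ select q S hS '' B := ⟨b, hb, rfl⟩
    cases T with
    | select q' S' hS' T' =>
      obtain ⟨C, hC, h'⟩ := h
      have hm' := hm
      rw [hC] at hm'
      obtain ⟨c, -, hc⟩ := hm'
      injection hc with h1 h2
      subst h1 h2
      exact ⟨T', (select_injective _ _ _).image_injective hC ▸ h', rfl⟩
    | branch p S hS K =>
      obtain ⟨S', _, K', h1, -⟩ := h.1 _ hm
      cases h1
    | send => obtain ⟨C, hC, -⟩ := h; rw [hC] at hm; obtain ⟨_, -, hc⟩ := hm; cases hc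
    | recv => obtain ⟨C, hC, -⟩ := h; rw [hC] at hm; obtain ⟨_, -, hc⟩ := hm; cases hc
    | mu => obtain ⟨C, hC, -⟩ := h; rw [hC] at hm; obtain ⟨_, -, hc⟩ := hm; cases hc
    | var => rw [show _ = _ from h] at hm; cases hm
    | ended => rw [show _ = _ from h] at hm; cases hm
  · rintro ⟨T', h, rfl⟩
    exact ⟨B, rfl, h⟩

/-- Receiving branchings with the same label set are merged label by label. -/
theorem isMerge_branch_image {T : LType P L V} {p : P} {S : Finset L} {hS : S.Nonempty}
    {B : Set (S → LType P L V)} :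
    T.IsMerge (branch p S hS '' B) ↔
      B.Nonempty ∧ ∃ T' : S → LType P L V, (∀ l, (T' l).IsMerge ((fun K => K l) '' B)) ∧
        T = branch p S hS T' := by
  have key : ∀ (l : L) (hl : l ∈ S), {Y : LType P L V | ∃ S' hS' K, ∃ h : l ∈ S',
      branch p S' hS' K ∈ branch p S hS '' B ∧ Y = K ⟨l, h⟩} = (fun K => K ⟨l, hl⟩) '' B := by
    intro l hl
    ext Y
    constructor
    · rintro ⟨S', hS', K, h, ⟨b, hb, e⟩, rfl⟩
      injection e with _ e1 e2
      subst e1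
      rw [heq_eq_eq] at e2
      subst e2
      exact ⟨b, hb, rfl⟩
    · rintro ⟨b, hb, rfl⟩
      exact ⟨S, hS, b, hl, ⟨b, hb, rfl⟩, rfl⟩
  constructor
  · intro h
    obtain ⟨_, b, hb, rfl⟩ := h.nonempty
    have hm : branch p S hS b ∈ branch p S hS '' B := ⟨b, hb, rfl⟩
    refine ⟨⟨b, hb⟩, ?_⟩
    cases T with
    | branch p' S' hS' T' =>
      obtain ⟨h1, h2⟩ := h
      obtain ⟨S₁, _, K, e, hsub⟩ := h1 _ hm
      injection e with e1 e2
      subst e1 e2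
      -- The definition only says that the merged label set contains that of every member. It has no
      -- further labels, since the continuations at such a label would form an empty family.
      have hS'S : S' = S := by
        refine Finset.Subset.antisymm (fun l hl => ?_) hsub
        obtain ⟨_, S₂, _, K₂, hl₂, ⟨b₂, _, e₂⟩, -⟩ := (h2 ⟨l, hl⟩).nonempty
        injection e₂ with _ e₃
        exact e₃ ▸ hl₂
      subst hS'S
      exact ⟨T', fun l => key l l.2 ▸ h2 l, rfl⟩
    | send => obtain ⟨C, hC, -⟩ := h; rw [hC] at hm; obtain ⟨_, -, hc⟩ := hm; cases hc
    | recv => obtain ⟨C, hC, -⟩ := h; rw [hC] at hm; obtain ⟨_, -, hc⟩ := hm; cases hc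
    | select => obtain ⟨C, hC, -⟩ := h; rw [hC] at hm; obtain ⟨_, -, hc⟩ := hm; cases hc
    | mu => obtain ⟨C, hC, -⟩ := h; rw [hC] at hm; obtain ⟨_, -, hc⟩ := hm; cases hc
    | var => rw [show _ = _ from h] at hm; cases hm
    | ended => rw [show _ = _ from h] at hm; cases hm
  · rintro ⟨-, T', h, rfl⟩
    refine ⟨?_, fun l => ?_⟩
    · rintro _ ⟨b, -, rfl⟩
      exact ⟨S, hS, b, rfl, subset_rfl⟩
    · rw [key l l.2]
      exact h l

theorem isMerge_mu_image {T : LType P L V} {B : Set (LType P L V)} :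
    T.IsMerge (mu '' B) ↔ ∃ T', T'.IsMerge B ∧ T = mu T' := by
  constructor
  · intro h
    obtain ⟨_, b, hb, rfl⟩ := h.nonempty
    have hm : mu b ∈ mu '' B := ⟨b, hb, rfl⟩
    cases T with
    | mu T' =>
      obtain ⟨C, hC, h'⟩ := h
      exact ⟨T', mu_injective.image_injective hC ▸ h', rfl⟩
    | branch p S hS K =>
      obtain ⟨S', _, K', h1, -⟩ := h.1 _ hm
      cases h1
    | send => obtain ⟨C, hC, -⟩ := h; rw [hC] at hm; obtain ⟨_, -, hc⟩ := hm; cases hc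
    | recv => obtain ⟨C, hC, -⟩ := h; rw [hC] at hm; obtain ⟨_, -, hc⟩ := hm; cases hc
    | select => obtain ⟨C, hC, -⟩ := h; rw [hC] at hm; obtain ⟨_, -, hc⟩ := hm; cases hc
    | var => rw [show _ = _ from h] at hm; cases hm
    | ended => rw [show _ = _ from h] at hm; cases hm
  · rintro ⟨T', h, rfl⟩
    exact ⟨B, rfl, h⟩

/-- The merge is a partial function. -/
theorem IsMerge.unique {T T' : LType P L V} {A : Set (LType P L V)} (h : T.IsMerge A)
    (h' : T'.IsMerge A) : T = T' := by
  induction T generalizing T' A with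
  | send q U T ih =>
    obtain ⟨B, rfl, h⟩ := h
    obtain ⟨T₁, h₁, rfl⟩ := isMerge_send_image.1 h'
    rw [ih h h₁]
  | recv q U T ih =>
    obtain ⟨B, rfl, h⟩ := h
    obtain ⟨T₁, h₁, rfl⟩ := isMerge_recv_image.1 h'
    rw [ih h h₁]
  | select q S hS T ih =>
    obtain ⟨B, rfl, h⟩ := h
    obtain ⟨T₁, h₁, rfl⟩ := isMerge_select_image.1 h'
    rw [show T = T₁ from funext fun l => ih l (h l) (h₁ l)]
  | branch p S hS T ih =>
    obtain ⟨_, hX⟩ := h.nonempty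
    obtain ⟨S₁, hS₁, K, rfl, hsub⟩ := h.1 _ hX
    cases T' with
    | branch p' S' hS' T' =>
      obtain ⟨_, _, _, e, -⟩ := h'.1 _ hX
      injection e with e1
      subst e1
      -- Both label sets are the union of those of the members: a label of either one has a nonempty
      -- family of continuations, hence occurs in some member, whose labels all lie in the other.
      have e : S = S' := by
        apply Finset.Subset.antisymm
        · intro l hl
          obtain ⟨_, S₂, hS₂, K₂, hl₂, hm, -⟩ := (h.2 ⟨l, hl⟩).nonempty
          obtain ⟨_, _, _, e, hsub⟩ := h'.1 _ hm
          injection e with _ e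
          exact hsub (e ▸ hl₂)
        · intro l hl
          obtain ⟨_, S₂, hS₂, K₂, hl₂, hm, -⟩ := (h'.2 ⟨l, hl⟩).nonempty
          obtain ⟨_, _, _, e, hsub⟩ := h.1 _ hm
          injection e with _ e
          exact hsub (e ▸ hl₂)
      subst e
      rw [show T = T' from funext fun l => ih l (h.2 l) (h'.2 l)]
    | send => obtain ⟨C, hC, -⟩ := h'; rw [hC] at hX; obtain ⟨_, -, hc⟩ := hX; cases hc
    | recv => obtain ⟨C, hC, -⟩ := h'; rw [hC] at hX; obtain ⟨_, -, hc⟩ := hX; cases hc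
    | select => obtain ⟨C, hC, -⟩ := h'; rw [hC] at hX; obtain ⟨_, -, hc⟩ := hX; cases hc
    | mu => obtain ⟨C, hC, -⟩ := h'; rw [hC] at hX; obtain ⟨_, -, hc⟩ := hX; cases hc
    | var => rw [show _ = _ from h'] at hX; cases hX
    | ended => rw [show _ = _ from h'] at hX; cases hX
  | var n =>
    obtain rfl : A = {var n} := h
    cases T' with
    | var m => exact Set.singleton_injective h'
    | branch p S hS K => obtain ⟨_, _, _, e, -⟩ := h'.1 _ rfl; cases e
    | ended => exact Set.singleton_injective h'
    | _ =>
      obtain ⟨C, hC, -⟩ := h'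
      obtain ⟨_, -, hc⟩ := hC ▸ Set.mem_singleton (var n)
      cases hc
  | mu T ih =>
    obtain ⟨B, rfl, h⟩ := h
    obtain ⟨T₁, h₁, rfl⟩ := isMerge_mu_image.1 h'
    rw [ih h h₁]
  | ended =>
    obtain rfl : A = {ended} := h
    cases T' with
    | var m => exact Set.singleton_injective h'
    | branch p S hS K => obtain ⟨_, _, _, e, -⟩ := h'.1 _ rfl; cases e
    | ended => rfl
    | _ =>
      obtain ⟨C, hC, -⟩ := h'
      obtain ⟨_, -, hc⟩ := hC ▸ Set.mem_singleton ended
      cases hc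

theorem isMerge_singleton_self (T : LType P L V) : T.IsMerge {T} := by
  induction T with
  | send q U T ih => exact ⟨{T}, Set.image_singleton.symm, ih⟩
  | recv q U T ih => exact ⟨{T}, Set.image_singleton.symm, ih⟩
  | select q S hS T ih =>
    exact ⟨{T}, Set.image_singleton.symm, fun l => by simpa using ih l⟩
  | branch p S hS T ih =>
    rw [← Set.image_singleton, isMerge_branch_image]
    exact ⟨Set.singleton_nonempty T, T, fun l => by simpa using ih l, rfl⟩
  | var n => rfl
  | mu T ih => exact ⟨{T}, Set.image_singleton.symm, ih⟩
  | ended => rfl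

/-- The merge is idempotent. -/
theorem isMerge_singleton_iff {T X : LType P L V} : T.IsMerge {X} ↔ T = X :=
  ⟨fun h => h.unique (isMerge_singleton_self X), fun h => h ▸ isMerge_singleton_self T⟩

end LType

/-! ### Projection: uniqueness and computation rules -/

/-- The projection is a partial function. -/
theorem IsProj.unique {r : P} {G : GType P L V} {T T' : LType P L V} (h : IsProj r G T)
    (h' : IsProj r G T') : T = T' := by
  induction G generalizing T T' with
  | comm p q U G ih =>
    unfold IsProj at h h'
    split_ifs at h h'
    · obtain ⟨X, hX, rfl⟩ := h
      obtain ⟨Y, hY, rfl⟩ := h'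
      rw [ih hX hY]
    · obtain ⟨X, hX, rfl⟩ := h
      obtain ⟨Y, hY, rfl⟩ := h'
      rw [ih hX hY]
    · exact ih h h'
  | branch p q S hS G ih =>
    obtain ⟨X, hX, h⟩ := h
    obtain ⟨Y, hY, h'⟩ := h'
    obtain rfl : X = Y := funext fun l => ih l (hX l) (hY l)
    split_ifs at h h'
    · rw [h, h']
    · rw [h, h']
    · exact h.unique h'
  | var n => exact Eq.trans h (Eq.symm h')
  | mu G ih =>
    obtain ⟨X, hX, h⟩ := h
    obtain ⟨Y, hY, h'⟩ := h'
    obtain rfl := ih hX hY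
    split_ifs at h h' <;> rw [h, h']
  | ended => exact Eq.trans h (Eq.symm h')

namespace IsProj

variable {r p q : P} {T : LType P L V} {U : V} {S : Finset L} {hS : S.Nonempty}

theorem comm_sender {G : GType P L V} (hp : r = p) :
    IsProj r (.comm p q U G) T ↔ ∃ T', IsProj r G T' ∧ T = .send q U T' := by
  rw [IsProj, if_pos hp]

theorem comm_receiver {G : GType P L V} (hp : r ≠ p) (hq : r = q) :
    IsProj r (.comm p q U G) T ↔ ∃ T', IsProj r G T' ∧ T = .recv p U T' := by
  rw [IsProj, if_neg hp, if_pos hq]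

theorem comm_other {G : GType P L V} (hp : r ≠ p) (hq : r ≠ q) :
    IsProj r (.comm p q U G) T ↔ IsProj r G T := by
  rw [IsProj, if_neg hp, if_neg hq]

theorem branch_sender {G : S → GType P L V} (hp : r = p) :
    IsProj r (.branch p q S hS G) T ↔
      ∃ T' : S → LType P L V, (∀ l, IsProj r (G l) (T' l)) ∧ T = .select q S hS T' := by
  simp only [IsProj, if_pos hp]

theorem branch_receiver {G : S → GType P L V} (hp : r ≠ p) (hq : r = q) :
    IsProj r (.branch p q S hS G) T ↔
      ∃ T' : S → LType P L V, (∀ l, IsProj r (G l) (T' l)) ∧ T = .branch p S hS T' := by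
  simp only [IsProj, if_neg hp, if_pos hq]

theorem branch_other {G : S → GType P L V} (hp : r ≠ p) (hq : r ≠ q) :
    IsProj r (.branch p q S hS G) T ↔
      ∃ T' : S → LType P L V, (∀ l, IsProj r (G l) (T' l)) ∧ T.IsMerge (Set.range T') := by
  simp only [IsProj, if_neg hp, if_neg hq]

/-- A branching with equal continuations is projected, on a participant that is not involved, to
the projection of the continuation. -/
theorem branch_const_other {G : GType P L V} (hp : r ≠ p) (hq : r ≠ q) :
    IsProj r (.branch p q S hS (fun _ => G)) T ↔ IsProj r G T := by
  have := hS.to_subtype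
  rw [branch_other hp hq]
  constructor
  · rintro ⟨T', h, hT⟩
    let l := Classical.arbitrary S
    -- Uniqueness of projection makes the family constant, so its merge is that of a singleton.
    rw [show T' = fun _ => T' l from funext fun k => (h k).unique (h l), Set.range_const, LType.isMerge_singleton_iff] at hT
    exact hT ▸ h l
  · intro h
    exact ⟨fun _ => T, fun _ => h, by rw [Set.range_const]; exact LType.isMerge_singleton_self T⟩

/-! ### The isomorphism combinators seen from one participant -/

theorem comm_congr {G G' : GType P L V} (h : ∀ T, IsProj r G T ↔ IsProj r G' T) :
    IsProj r (.comm p q U G) T ↔ IsProj r (.comm p q U G') T := by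
  simp only [IsProj, h]

theorem swap {p' q' : P} {U' : V} {G : GType P L V} (hp : r ≠ p) (hq : r ≠ q) :
    IsProj r (.comm p q U (.comm p' q' U' G)) T ↔
      IsProj r (.comm p' q' U' (.comm p q U G)) T := by
  rw [comm_other hp hq]
  exact comm_congr fun T => (comm_other hp hq).symm

theorem contr_of_notMem_comm {p' q' : P} {G : S → GType P L V} (hp' : r ≠ p') (hq' : r ≠ q') :
    IsProj r (.branch p q S hS (fun l => .comm p' q' U (G l))) T ↔
      IsProj r (.comm p' q' U (.branch p q S hS G)) T := by
  rw [comm_other hp' hq']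
  simp only [IsProj, if_neg hp', if_neg hq']

/-- The left side merges local types that all begin with the same action of `r`, the right side puts
that action in front of the merge; if `r` has no such action, the communication is invisible on both
sides. -/
theorem contr_of_notMem_branch {p' q' : P} {G : S → GType P L V} (hp : r ≠ p) (hq : r ≠ q) :
    IsProj r (.branch p q S hS (fun l => .comm p' q' U (G l))) T ↔
      IsProj r (.comm p' q' U (.branch p q S hS G)) T := by
  by_cases hp' : r = p'
  · simp only [branch_other hp hq, comm_sender hp']
    constructor
    · rintro ⟨T', h, hT⟩
      choose X hX e using h
      rw [show T' = LType.send q' U ∘ X from funext e, Set.range_comp,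
        LType.isMerge_send_image] at hT
      obtain ⟨Y, hY, rfl⟩ := hT
      exact ⟨Y, ⟨X, hX, hY⟩, rfl⟩
    · rintro ⟨Y, ⟨X, hX, hY⟩, rfl⟩
      refine ⟨LType.send q' U ∘ X, fun l => ⟨X l, hX l, rfl⟩, ?_⟩
      rw [Set.range_comp, LType.isMerge_send_image]
      exact ⟨Y, hY, rfl⟩
  by_cases hq' : r = q'
  · simp only [branch_other hp hq, comm_receiver hp' hq']
    constructor
    · rintro ⟨T', h, hT⟩
      choose X hX e using h
      rw [show T' = LType.recv p' U ∘ X from funext e, Set.range_comp,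
        LType.isMerge_recv_image] at hT
      obtain ⟨Y, hY, rfl⟩ := hT
      exact ⟨Y, ⟨X, hX, hY⟩, rfl⟩
    · rintro ⟨Y, ⟨X, hX, hY⟩, rfl⟩
      refine ⟨LType.recv p' U ∘ X, fun l => ⟨X l, hX l, rfl⟩, ?_⟩
      rw [Set.range_comp, LType.isMerge_recv_image]
      exact ⟨Y, hY, rfl⟩
  exact contr_of_notMem_comm hp' hq'

/-- If `r` is `p` or `q`, its own choice over `S` stands outside or inside the merge over `S'`, and
the merge works label by label. Otherwise the branching over `S` has constant continuations and
disappears. -/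
theorem distrib {p' q' : P} {S' : Finset L} {hS' : S'.Nonempty} {G : S' → GType P L V}
    (hp' : r ≠ p') (hq' : r ≠ q') :
    IsProj r (.branch p q S hS (fun _ => .branch p' q' S' hS' G)) T ↔
      IsProj r (.branch p' q' S' hS' (fun k => .branch p q S hS (fun _ => G k))) T := by
  have := hS'.to_subtype
  have range_eval (X : S' → S → LType P L V) (l : S) :
      (fun K : S → LType P L V => K l) '' Set.range X = Set.range fun k => X k l := by
    rw [← Set.range_comp]; rfl
  by_cases hp : r = p
  · rw [branch_other hp' hq']
    simp only [branch_sender hp, branch_other hp' hq']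
    constructor
    · rintro ⟨T', h, rfl⟩
      choose X hX hT using h
      -- Transposing the doubly indexed family `X` exchanges the choice with the merge.
      refine ⟨_, fun k => ⟨fun l => X l k, fun l => hX l k, rfl⟩, ?_⟩
      rw [Set.range_comp' (LType.select q S hS), LType.isMerge_select_image]
      refine ⟨T', fun l => ?_, rfl⟩
      rw [range_eval]
      exact hT l
    · rintro ⟨T', h, hT⟩
      choose X hX e using h
      rw [show T' = LType.select q S hS ∘ X from funext e, Set.range_comp,
        LType.isMerge_select_image] at hT
      obtain ⟨Y, hY, rfl⟩ := hT
      refine ⟨Y, fun l => ⟨fun k => X k l, fun k => hX k l, ?_⟩, rfl⟩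
      rw [← range_eval]
      exact hY l
  by_cases hq : r = q
  · rw [branch_other hp' hq']
    simp only [branch_receiver hp hq, branch_other hp' hq']
    constructor
    · rintro ⟨T', h, rfl⟩
      choose X hX hT using h
      refine ⟨_, fun k => ⟨fun l => X l k, fun l => hX l k, rfl⟩, ?_⟩
      rw [Set.range_comp' (LType.branch p S hS), LType.isMerge_branch_image]
      refine ⟨Set.range_nonempty _, T', fun l => ?_, rfl⟩
      rw [range_eval]
      exact hT l
    · rintro ⟨T', h, hT⟩
      choose X hX e using h
      rw [show T' = LType.branch p S hS ∘ X from funext e, Set.range_comp,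
        LType.isMerge_branch_image] at hT
      obtain ⟨-, Y, hY, rfl⟩ := hT
      refine ⟨Y, fun l => ⟨fun k => X k l, fun k => hX k l, ?_⟩, rfl⟩
      rw [← range_eval]
      exact hY l
  rw [branch_const_other hp hq, branch_other hp' hq', branch_other hp' hq']
  simp only [branch_const_other hp hq]

end IsProj

/-! ### Invariance of projections and participants -/

namespace GType

/-- This is the only use of disjointness: it splits each combinator into two cases, each with one
communication foreign to `r`. -/
theorem ne_or_ne_of_disjoint {p q p' q' : P} (h : Disjoint ({p, q} : Set P) {p', q'}) (r : P) :
    (r ≠ p ∧ r ≠ q) ∨ (r ≠ p' ∧ r ≠ q') := by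
  by_contra! hr
  have h' : r ∈ ({p, q} : Set P) → r ∉ ({p', q'} : Set P) := fun hr => Set.disjoint_left.1 h hr
  refine h' ?_ ?_
  · simpa [or_iff_not_imp_left] using hr.1
  · simpa [or_iff_not_imp_left] using hr.2

/-- Isomorphic global types have the same projections. -/
theorem Iso.isProj_iff {G G' : GType P L V} (h : Iso G G') (r : P) (T : LType P L V) :
    IsProj r G T ↔ IsProj r G' T := by
  induction h generalizing T with
  | swap p q U p' q' U' G h =>
    rcases ne_or_ne_of_disjoint h r with ⟨hp, hq⟩ | ⟨hp, hq⟩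
    · exact IsProj.swap hp hq
    · exact (IsProj.swap hp hq).symm
  | contr p q S hS p' q' U G h =>
    rcases ne_or_ne_of_disjoint h r with ⟨hp, hq⟩ | ⟨hp, hq⟩
    · exact IsProj.contr_of_notMem_branch hp hq
    · exact IsProj.contr_of_notMem_comm hp hq
  | distrib p q S hS p' q' S' hS' G h =>
    rcases ne_or_ne_of_disjoint h r with ⟨hp, hq⟩ | ⟨hp, hq⟩
    -- The branching of `p` and `q` has constant continuations, so it vanishes for `r`, on the
    -- outside here and inside each branch below, whatever the role of `r` in the other branching.
    · rw [IsProj.branch_const_other hp hq]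
      unfold IsProj
      simp only [IsProj.branch_const_other hp hq]
    · exact IsProj.distrib hp hq
  | refl => rfl
  | symm _ ih => exact (ih T).symm
  | trans _ _ ih ih' => exact (ih T).trans (ih' T)
  | comm_congr p q U _ ih => exact IsProj.comm_congr ih
  | branch_congr p q S hS _ ih => simp only [IsProj, ih]
  | mu_congr _ ih => simp only [IsProj, ih]

/-- Isomorphic global types have the same participants. -/
theorem Iso.participants_eq {G G' : GType P L V} (h : Iso G G') :
    G.participants = G'.participants := by
  induction h with
  | swap => exact Set.union_left_comm ..
  | contr p q S hS p' q' U G h =>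
    have := hS.to_subtype
    simp only [participants, ← Set.union_iUnion]
    exact Set.union_left_comm ..
  | distrib p q S hS p' q' S' hS' G h =>
    have := hS.to_subtype
    have := hS'.to_subtype
    simp only [participants, ← Set.union_iUnion, Set.iUnion_const]
    exact Set.union_left_comm ..
  | refl => rfl
  | symm _ ih => exact ih.symm
  | trans _ _ ih ih' => exact ih.trans ih'
  | comm_congr p q U _ ih => simp only [participants, ih]
  | branch_congr p q S hS _ ih => simp only [participants, ih]
  | mu_congr _ ih => exact ih

end GType

/-- The type of configurations depends on the set of participants; an arbitrary equal set `R` lets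
two denotations be compared over one index set without transport. -/
theorem denotation_eq_of_participants {G : GType P L V} {R : Set P} (h : G.participants = R) :
    denotation G = {σ | ∃ Δ Δ' : Config P L V R, IsProjConfig G Δ ∧ Exec Δ σ Δ' ∧
      ¬ ∃ p q m Δ'', SyncStep Δ' p q m Δ''} := by
  subst h
  rfl

end

/-! ### Equality of runs, traces and denotations -/

theorem theorem2 {P L V : Type*} (G₁ G₂ : GType P L V) (h : GType.Iso G₁ G₂) :
    (∀ (R : Set P) (Δ₁ Δ₂ : Config P L V R), IsProjConfig G₁ Δ₁ → IsProjConfig G₂ Δ₂ →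
      runSet Δ₁ = runSet Δ₂ ∧ traceSet Δ₁ = traceSet Δ₂) ∧
    denotation G₁ = denotation G₂ := by
  refine ⟨fun R Δ₁ Δ₂ h₁ h₂ => ?_, ?_⟩
  · obtain rfl : Δ₁ = Δ₂ := funext fun p => ((h.isProj_iff p _).1 (h₁ p)).unique (h₂ p)
    exact ⟨rfl, rfl⟩
  · rw [denotation_eq_of_participants h.participants_eq, denotation_eq_of_participants rfl]
    simp only [IsProjConfig, h.isProj_iff]
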